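/- Let $q$ be a prime power, let $\alpha$ be a primitive element of $\mathbb{F}_{q^4}$ (a generator of the multiplicative group), let $C=\{\,j(q+1) : j=0,1,\dots,q^2\,\}$, and let $v$ be a positive divisor of $q-1$ such that $q\ge v^3+4v$. Put $w=(q^4-1)/(q-1)=q^3+q^2+q+1$ and $\omega=\alpha^{w}$, which is a primitive element of $\mathbb{F}_q$; for $x\in\mathbb{F}_q^{\times}$ let $\log_\omega x$ be the unique $i\in\{0,\dots,q-2\}$ with $\omega^i=x$, and let $\mathrm{Tr}$ be the trace from $\mathbb{F}_{q^4}$ to $\mathbb{F}_q$. Let $\mathcal{A}_{q^4/q}(\alpha,C;v)$ be the array with rows indexed by $i\in\{0,\dots,vw-1\}$, columns indexed by $c\in C$, and entries \[ \mathcal{A}_{q^4/q}(\alpha,C;v)_{i,c}=\begin{cases}\log_\omega\!\bigl(\mathrm{Tr}(\alpha^{i+c})\bigr)\bmod v, & \mathrm{Tr}(\alpha^{i+c})\neq 0,\\ 0, & \text{otherwise.}\end{cases} \] Then $\mathcal{A}_{q^4/q}(\alpha,C;v)$ is a covering array $\mathrm{CA}\bigl(v(q^3+q^2+q+1);\,4,\,q^2+1,\,v\bigr)$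 over the alphabet $\{0,\dots,v-1\}$. Here an $N\times k$ array with entries from an alphabet $V$ of cardinality $v$ is a $\mathrm{CA}(N;t,k,v)$ if $1\le t\le k$, $v^t\le N$, and for every choice of $t$ of its columns each $t$-tuple in $V^t$ appears at least once as a row of the $N\times t$ subarray formed by these columns. -/

import Mathlib

/-- `α` is a primitive element of the (finite) field `L`: its powers are exactly the nonzero
elements of `L`, so that `α` generates the multiplicative group of `L`. -/
def IsPrimitiveElement {L : Type*} [Field L] (α : L) : Prop :=
  α ≠ 0 ∧ ∀ x : L, x ≠ 0 → ∃ n : ℕ, α ^ n = x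

/-- The discrete logarithm of `x` with base `ω`: the least natural number `i` with `ω ^ i = x`.
If `ω` generates a cyclic group of order `n` containing `x`, this is the unique such `i` in
`[0, n - 1]`. -/
noncomputable def discreteLog {M : Type*} [Monoid M] (ω x : M) : ℕ :=
  sInf {i : ℕ | ω ^ i = x}

/-- The number `(q ^ t - 1) / (q - 1)`, where `q` and `q ^ t` are the numbers of elements of the
finite field `F` and of its extension `L`. The division is exact. -/
noncomputable def pointCount (F L : Type*) : ℕ :=
  (Nat.card L - 1) / (Nat.card F - 1)

open Classical in
/-- The cyclic trace array modulo `v` corresponding to an element `α` of the finite extension `L`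
of the finite field `F` and to a finite set `C` of natural numbers. Its rows are indexed by
`i = 0, …, v * w - 1` with `w = (q ^ t - 1) / (q - 1)`, its columns by the elements `c` of `C` (in
increasing order), and its `(i, c)` entry is `log_ω (Tr (α ^ (i + c))) mod v` with `ω = α ^ w` if
`Tr (α ^ (i + c)) ≠ 0`, and `0` otherwise, where `Tr` is the trace from `L` to `F`, and `F` is
regarded as a subfield of `L`. -/
noncomputable def cyclicTraceArrayMod (F : Type*) {L : Type*} [Field F] [Field L] [Algebra F L]
    (α : L) (C : Finset ℕ) (v : ℕ) : Matrix (Fin (v * pointCount F L)) C ℕ :=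
  Matrix.of fun i c =>
    if Algebra.trace F L (α ^ ((i : ℕ) + (c : ℕ))) = 0 then 0
    else discreteLog (α ^ pointCount F L)
      (algebraMap F L (Algebra.trace F L (α ^ ((i : ℕ) + (c : ℕ))))) % v

/-- `A`, with rows indexed by `R` and columns indexed by `K`, is a covering array
`CA(N; t, k, v)` over the alphabet `V`: it is an `N × k` array with entries from `V`, `V` has `v`
elements, `1 ≤ t ≤ k`, `v ^ t ≤ N`, and for every set `T` of `t` columns, every assignment `x` of
symbols of `V` to the columns in `T` appears in at least one row of `A`. -/
structure IsCoveringArray {R K S : Type*} [Fintype R] [Fintype K] (A : Matrix R K S)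
    (V : Finset S) (N t k v : ℕ) : Prop where
  card_rows : Fintype.card R = N
  card_cols : Fintype.card K = k
  card_alphabet : V.card = v
  mem_alphabet : ∀ r j, A r j ∈ V
  strength_pos : 0 < t
  strength_le : t ≤ k
  pow_le : v ^ t ≤ N
  covers : ∀ T : Finset K, T.card = t → ∀ x : K → S, (∀ j ∈ T, x j ∈ V) →
    ∃ r, ∀ j ∈ T, A r j = x j

/-! Put `n = (q - 1) / v` and let `H` be the group of `v`-th powers in `Fˣ`, of order `n`. An entry
is `s` as soon as its trace lies in the coset `ω ^ s * H`, so four given columns `c` call for some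
`y` with each `Tr (y * α ^ c)` in a prescribed coset.

The `α ^ c` represent points of an elliptic quadric, on which `x ^ (q ^ 2 + 1)` lies in `F`, so any
three are independent (`linearIndependent_of_pow_sq_add_one_mem`). If all four are independent,
nondegeneracy of the trace form gives `y`. Otherwise they satisfy a relation with all coefficients
nonzero, and the traces must solve it: a diagonal equation over `H`, soluble by a character sum
estimate (`exists_sum_mul_subgroup_eq_zero`) when `(q - n) ^ 2 < n ^ 3`, which `q ≥ v ^ 3 + 4 * v`
ensures. -/

open Finset in
/-- A diagonal equation in four variables has a solution in every subgroup of `Fˣ` that is large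
enough, by Parseval's identity for the Gaussian periods of the subgroup. -/
theorem exists_sum_mul_subgroup_eq_zero {F : Type*} [Field F] [Fintype F] (H : Subgroup Fˣ)
    (hH : (Fintype.card F - Nat.card H) ^ 2 < Nat.card H ^ 3) (c : Fin 4 → F)
    (hc : ∀ j, c j ≠ 0) : ∃ h : Fin 4 → H, ∑ j, c j * ((h j : Fˣ) : F) = 0 := by
  classical
  obtain ⟨ψ, hψ1⟩ := AddChar.exists_apply_ne_zero.mpr (one_ne_zero : (1 : F) ≠ 0)
  have hψ : ψ.IsPrimitive := AddChar.IsPrimitive.of_ne_one fun h => hψ1 (by simp [h])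
  set n := Nat.card H with hn
  set q := Fintype.card F with hq
  have hnH : Fintype.card H = n := by rw [hn, Nat.card_eq_fintype_card]
  have hn0 : 0 < n := Nat.card_pos
  have hnq : n ≤ q := by
    rw [← hnH]
    exact Fintype.card_le_of_injective (fun h : H => ((h : Fˣ) : F))
      fun a b h => Subtype.ext (Units.ext h)
  let η : F → ℂ := fun s => ∑ h : H, ψ (s * ((h : Fˣ) : F))
  have hη0 : η 0 = n := by simp [η, hnH]
  have hηmul : ∀ s (k : H), η (s * ((k : Fˣ) : F)) = η s := fun s k =>
    Fintype.sum_equiv (Equiv.mulLeft k) _ _ fun h => by simp [mul_assoc]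
  have hparseval : ∑ s, ‖η s‖ ^ 2 = (q * n : ℝ) := by
    have hC : ∑ s, (η s * (starRingEnd ℂ) (η s)) = (q * n : ℂ) := by
      have : ∀ s, η s * (starRingEnd ℂ) (η s) =
          ∑ h : H, ∑ k : H, ψ (s * (((h : Fˣ) : F) - ((k : Fˣ) : F))) := fun s => by
        simp only [η, map_sum, sum_mul_sum, sub_eq_add_neg, mul_add, mul_neg,
          AddChar.map_add_eq_mul, AddChar.map_neg_eq_conj]
      simp_rw [this]
      rw [sum_comm]
      simp_rw [sum_comm (s := (univ : Finset F)), AddChar.sum_mulShift _ hψ, sub_eq_zero,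
        Units.val_inj, Subtype.val_inj]
      simp [hnH, mul_comm, ← hq]
    have := congrArg Complex.re hC
    simp only [Complex.mul_conj'] at this
    exact_mod_cast this
  have hsum : ∑ s ∈ univ.erase 0, ‖η s‖ ^ 2 = (n * (q - n) : ℝ) := by
    have := add_sum_erase univ (fun s => ‖η s‖ ^ 2) (mem_univ (0 : F))
    rw [hparseval] at this
    simp only [hη0, Complex.norm_natCast] at this
    linarith
  -- `‖η‖` is constant on the coset `s * H`, whose `n` elements together contribute at most the
  -- whole sum over nonzero arguments.
  have hbound : ∀ s, s ≠ 0 → ‖η s‖ ^ 2 ≤ (q - n : ℝ) := fun s hs => by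
    have h1 : ∑ t ∈ univ.image (fun k : H => s * ((k : Fˣ) : F)), ‖η t‖ ^ 2
        = n * ‖η s‖ ^ 2 := by
      rw [sum_image fun a _ b _ h => Subtype.ext (Units.ext (mul_left_cancel₀ hs h))]
      simp [hηmul, hnH]
    have h2 : ∑ t ∈ univ.image (fun k : H => s * ((k : Fˣ) : F)), ‖η t‖ ^ 2
        ≤ ∑ t ∈ univ.erase 0, ‖η t‖ ^ 2 := by
      refine sum_le_sum_of_subset_of_nonneg (fun t ht => ?_) fun _ _ _ => by positivity
      obtain ⟨k, -, rfl⟩ := mem_image.mp ht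
      simp [hs]
    rw [h1, hsum] at h2
    exact le_of_mul_le_mul_left h2 (by exact_mod_cast hn0)
  by_contra! hne
  -- By orthogonality this sum is `q` times the number of solutions.
  have hzero : ∑ s, ∏ j, η (c j * s) = 0 := by
    have : ∀ s, ∏ j, η (c j * s) = ∑ h : Fin 4 → H, ψ (s * ∑ j, c j * ((h j : Fˣ) : F)) :=
      fun s => by
        simp only [η, prod_univ_sum, Fintype.piFinset_univ]
        refine sum_congr rfl fun h _ => ?_
        simp only [Fin.prod_univ_four, Fin.sum_univ_four, mul_add, AddChar.map_add_eq_mul,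
          mul_assoc, mul_left_comm s]
    simp_rw [this]
    rw [sum_comm]
    simp [AddChar.sum_mulShift _ hψ, hne]
  have hscale : ∀ j, ∑ s ∈ univ.erase 0, ‖η (c j * s)‖ ^ 2 = (n * (q - n) : ℝ) := fun j => by
    rw [← hsum]
    refine sum_bij' (fun s _ => c j * s) (fun s _ => (c j)⁻¹ * s) ?_ ?_ ?_ ?_ ?_ <;>
      simp +contextual [hc j]
  -- The term `s = 0` equals `n ^ 4` and must be cancelled by the others. There, two factors are
  -- bounded pointwise, the other two on average by AM-GM and Parseval.
  have hmain : (n : ℝ) ^ 4 ≤ (q - n) * (n * (q - n)) := by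
    have h0 := add_sum_erase univ (fun s => ∏ j, η (c j * s)) (mem_univ (0 : F))
    rw [hzero] at h0
    simp only [mul_zero, hη0, prod_const, card_univ, Fintype.card_fin] at h0
    have h1 : (n : ℝ) ^ 4 = ‖∑ s ∈ univ.erase 0, ∏ j, η (c j * s)‖ := by
      rw [← norm_neg, ← eq_neg_of_add_eq_zero_left h0]
      simp
    rw [h1]
    calc _ ≤ ∑ s ∈ univ.erase 0, ‖∏ j, η (c j * s)‖ := norm_sum_le _ _
      _ ≤ ∑ s ∈ univ.erase 0,
          (q - n : ℝ) * ((‖η (c 2 * s)‖ ^ 2 + ‖η (c 3 * s)‖ ^ 2) / 2) := by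
        refine sum_le_sum fun s hs => ?_
        have hs : s ≠ 0 := ne_of_mem_erase hs
        rw [norm_prod, Fin.prod_univ_four, mul_assoc]
        have h0 := hbound _ (mul_ne_zero (hc 0) hs)
        have h1 := hbound _ (mul_ne_zero (hc 1) hs)
        refine mul_le_mul ?_ ?_ (by positivity) (by simpa using hnq)
        · nlinarith [sq_nonneg (‖η (c 0 * s)‖ - ‖η (c 1 * s)‖)]
        · nlinarith [sq_nonneg (‖η (c 2 * s)‖ - ‖η (c 3 * s)‖)]
      _ = _ := by
        rw [← mul_sum, ← sum_div, sum_add_distrib, hscale, hscale]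
        ring
  have h3 : ((q - n : ℕ) : ℝ) ^ 2 < (n : ℝ) ^ 3 := by exact_mod_cast hH
  rw [Nat.cast_sub hnq] at h3
  have hn0' : (0 : ℝ) < n := by exact_mod_cast hn0
  nlinarith

/-! ### Independence on the elliptic quadric -/

theorem FiniteField.mem_fieldRange_algebraMap_iff_pow_card (F : Type*) {L : Type*} [Field F]
    [Field L] [Algebra F L] [Finite L] (x : L) :
    x ∈ (algebraMap F L).fieldRange ↔ x ^ Nat.card F = x := by
  have : Finite F := Finite.of_injective _ (algebraMap F L).injective
  have := Fintype.ofFinite F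
  rw [Nat.card_eq_fintype_card]
  constructor
  · rintro ⟨y, rfl⟩
    rw [← map_pow, FiniteField.pow_card]
  · intro hx
    refine (IsGalois.mem_range_algebraMap_iff_fixed x).mpr fun f => ?_
    obtain ⟨k, rfl⟩ := (FiniteField.bijective_frobeniusAlgEquivOfAlgebraic_pow F L).2 f
    have : Function.IsFixedPt (⇑(FiniteField.frobeniusAlgEquivOfAlgebraic F L)) x := hx
    simpa [AlgEquiv.coe_pow] using (this.iterate k).eq

/-- With `φ` the Frobenius over `F`, the hypotheses say that `φ` fixes the product and the sum of
`e` and `φ (φ e)`. Hence `φ e` is a root of `(X - e) * (X - φ (φ e))`, and either root gives `φ e =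
e`. -/
theorem mem_fieldRange_of_pow_sq_add_one_mem {F L : Type*} [Field F] [Field L] [Algebra F L]
    [Finite L] {e : L} (h : e ^ (Nat.card F ^ 2 + 1) ∈ (algebraMap F L).fieldRange)
    (h' : (1 - e) ^ (Nat.card F ^ 2 + 1) ∈ (algebraMap F L).fieldRange) :
    e ∈ (algebraMap F L).fieldRange := by
  have : Finite F := Finite.of_injective _ (algebraMap F L).injective
  have := Fintype.ofFinite F
  let φ := FiniteField.frobeniusAlgHom F L
  have hφ : ∀ x, x ^ Nat.card F = φ x := fun x => by
    rw [Nat.card_eq_fintype_card]; rfl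
  have hφ2 : ∀ x, x ^ (Nat.card F ^ 2 + 1) = φ (φ x) * x := fun x => by
    rw [pow_succ, sq, pow_mul, hφ, hφ]
  simp only [FiniteField.mem_fieldRange_algebraMap_iff_pow_card, hφ, hφ2, map_mul, map_sub,
    map_one] at h h' ⊢
  have h0 : (φ e - e) * (φ e - φ (φ e)) = 0 := by linear_combination φ e * (h - h') - h
  rcases mul_eq_zero.mp h0 with h1 | h1
  · exact sub_eq_zero.mp h1
  · exact (φ.injective (sub_eq_zero.mp h1)).symm

/-- If `a ≠ 0`, dividing by `a • x` writes `1` as `e + (1 - e)`, with both summands satisfying the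
quadric condition. Then `e` lies in `F`, which forces `b = c = 0`. -/
theorem coeff_eq_zero_of_pow_sq_add_one_mem {F L : Type*} [Field F] [Field L] [Algebra F L]
    [Finite L] {x y z : L} (hx0 : x ≠ 0)
    (hx : x ^ (Nat.card F ^ 2 + 1) ∈ (algebraMap F L).fieldRange)
    (hy : y ^ (Nat.card F ^ 2 + 1) ∈ (algebraMap F L).fieldRange)
    (hz : z ^ (Nat.card F ^ 2 + 1) ∈ (algebraMap F L).fieldRange)
    (hyx : y / x ∉ (algebraMap F L).fieldRange) (hzx : z / x ∉ (algebraMap F L).fieldRange)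
    {a b c : F} (h : a • x + b • y + c • z = 0) : a = 0 := by
  by_contra ha
  have hK : ∀ r : F, algebraMap F L r ∈ (algebraMap F L).fieldRange := fun r => ⟨r, rfl⟩
  have hA : algebraMap F L a ≠ 0 := by simpa using ha
  have hscale : ∀ (r : F) (u : L), u ^ (Nat.card F ^ 2 + 1) ∈ (algebraMap F L).fieldRange →
      (algebraMap F L (-(r / a)) * (u / x)) ^ (Nat.card F ^ 2 + 1) ∈
        (algebraMap F L).fieldRange := fun r u hu => by
    rw [mul_pow, div_pow]
    exact mul_mem (pow_mem (hK _) _) (div_mem hu hx)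
  simp only [Algebra.smul_def] at h
  have hsub : 1 - algebraMap F L (-(b / a)) * (y / x) = algebraMap F L (-(c / a)) * (z / x) := by
    simp only [map_neg, map_div₀]
    field_simp
    linear_combination h
  have he := mem_fieldRange_of_pow_sq_add_one_mem (hscale b y hy) (hsub ▸ hscale c z hz)
  have hcancel : ∀ (r : F) (u : L), u ∉ (algebraMap F L).fieldRange →
      algebraMap F L (-(r / a)) * u ∈ (algebraMap F L).fieldRange → r = 0 := by
    intro r u hu hru
    by_contra hr
    have hne : algebraMap F L (-(r / a)) ≠ 0 := by simp [hr, ha]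
    exact hu (mul_div_cancel_left₀ u hne ▸ div_mem hru (hK (-(r / a))))
  have hb := hcancel b _ hyx he
  have hc := hcancel c _ hzx (hsub ▸ sub_mem (one_mem _) he)
  simp [hb, hc, hx0, ha] at h

/-- Three distinct points of the elliptic quadric are not collinear. -/
theorem linearIndependent_of_pow_sq_add_one_mem {F L : Type*} [Field F] [Field L] [Algebra F L]
    [Finite L] {a : Fin 3 → L} (h0 : ∀ i, a i ≠ 0)
    (ha : ∀ i, a i ^ (Nat.card F ^ 2 + 1) ∈ (algebraMap F L).fieldRange)
    (hdiv : ∀ i j, i ≠ j → a i / a j ∉ (algebraMap F L).fieldRange) : LinearIndependent F a := by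
  rw [Fintype.linearIndependent_iff]
  intro g hg
  rw [Fin.sum_univ_three] at hg
  rw [Fin.forall_fin_succ, Fin.forall_fin_two]
  refine ⟨coeff_eq_zero_of_pow_sq_add_one_mem (h0 0) (ha 0) (ha 1) (ha 2) (hdiv 1 0 (by decide))
    (hdiv 2 0 (by decide)) hg, coeff_eq_zero_of_pow_sq_add_one_mem (b := g 0) (c := g 2)
    (h0 1) (ha 1) (ha 0) (ha 2)
    (hdiv 0 1 (by decide)) (hdiv 2 1 (by decide)) ?_, coeff_eq_zero_of_pow_sq_add_one_mem
    (b := g 0) (c := g 1) (h0 2) (ha 2) (ha 0) (ha 1) (hdiv 0 2 (by decide))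
    (hdiv 1 2 (by decide)) ?_⟩
  · rw [← hg]; simp; abel
  · rw [← hg]; simp; abel

/-! ### Prescribing traces -/

theorem LinearIndependent.exists_trace_mul_eq {F L ι : Type*} [Field F] [Field L] [Algebra F L]
    [Finite L] {b : ι → L} (hb : LinearIndependent F b) (z : ι → F) :
    ∃ y : L, ∀ i, Algebra.trace F L (y * b i) = z i := by
  have : Finite F := Finite.of_injective _ (algebraMap F L).injective
  obtain ⟨f, hf⟩ := LinearMap.exists_extend ((Module.Basis.span hb).constr F z)
  refine ⟨((Algebra.traceForm F L).toDual (traceForm_nondegenerate F L)).symm f, fun i => ?_⟩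
  rw [← Algebra.traceForm_apply, LinearMap.BilinForm.apply_toDual_symm_apply]
  have h1 : f (Module.Basis.span hb i : L) = z i := by
    rw [← (Module.Basis.span hb).constr_basis F z i, ← hf]
    rfl
  rwa [Module.Basis.span_apply] at h1

/-- If any three members of a family of four are linearly independent, the traces of their
multiples by a common factor can be prescribed up to factors in a large subgroup of `Fˣ`. -/
theorem exists_trace_mul_mem_coset {F L : Type*} [Field F] [Field L] [Algebra F L] [Finite L]
    {a : Fin 4 → L} (ha : ∀ j : Fin 4, LinearIndependent F (a ∘ j.succAbove)) (H : Subgroup Fˣ)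
    (hH : (Nat.card F - Nat.card H) ^ 2 < Nat.card H ^ 3) (z : Fin 4 → Fˣ) :
    ∃ (y : L) (h : Fin 4 → H), ∀ j, Algebra.trace F L (y * a j) = z j * (h j : Fˣ) := by
  have : Finite F := Finite.of_injective _ (algebraMap F L).injective
  have := Fintype.ofFinite F
  rw [Nat.card_eq_fintype_card (α := F)] at hH
  by_cases hind : LinearIndependent F a
  · obtain ⟨y, hy⟩ := hind.exists_trace_mul_eq fun j => (z j : F)
    exact ⟨y, 1, by simpa using hy⟩
  obtain ⟨c, hca, i, hi⟩ := Fintype.not_linearIndependent_iff.mp hind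
  have hc : ∀ j, c j ≠ 0 := fun j hj => by
    rw [Fin.sum_univ_succAbove _ j, hj, zero_smul, zero_add] at hca
    have := Fintype.linearIndependent_iff.mp (ha j) (fun k => c (j.succAbove k)) hca
    rcases Fin.eq_self_or_eq_succAbove j i with rfl | ⟨k, rfl⟩
    · exact hi hj
    · exact hi (this k)
  obtain ⟨h, hh⟩ := exists_sum_mul_subgroup_eq_zero H hH (fun j => c j * z j)
    fun j => mul_ne_zero (hc j) (z j).ne_zero
  obtain ⟨y, hy⟩ := (ha 0).exists_trace_mul_eq
    fun k => (z (Fin.succAbove 0 k) * (h (Fin.succAbove 0 k) : Fˣ) : F)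
  refine ⟨y, h, fun j => ?_⟩
  rcases Fin.eq_self_or_eq_succAbove 0 j with rfl | ⟨k, rfl⟩
  -- The relation determines the remaining trace, and `hh` gives it the required value.
  · have h1 : ∑ j, c j * Algebra.trace F L (y * a j) = 0 := by
      have := congrArg (fun x => Algebra.trace F L (y * x)) hca
      simpa [Finset.mul_sum] using this
    rw [Fin.sum_univ_succAbove _ 0] at h1 hh
    simp only [Function.comp_apply] at hy
    simp only [hy] at h1
    refine mul_left_cancel₀ (hc 0) ?_
    simp only [mul_assoc] at h1 hh
    exact add_right_cancel (h1.trans hh.symm)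
  · exact hy k

/-! ### Logarithms and rows of the array -/

theorem IsPrimitiveElement.zpowers_eq_top {L : Type*} [Field L] {α : L}
    (hα : IsPrimitiveElement α) : Subgroup.zpowers (Units.mk0 α hα.1) = ⊤ := by
  refine (Subgroup.eq_top_iff' _).mpr fun x => ?_
  obtain ⟨n, hn⟩ := hα.2 x x.ne_zero
  exact ⟨n, by ext; simpa using hn⟩

theorem IsPrimitiveElement.exists_norm_pow_eq {F L : Type*} [Field F] [Field L] [Algebra F L]
    [Finite L] {α : L} (hα : IsPrimitiveElement α) {x : F} (hx : x ≠ 0) :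
    ∃ m : ℕ, Algebra.norm F α ^ m = x := by
  obtain ⟨y, rfl⟩ := FiniteField.norm_surjective F L x
  have hy : y ≠ 0 := by rintro rfl; simp [Algebra.norm_zero] at hx
  obtain ⟨m, rfl⟩ := hα.2 y hy
  exact ⟨m, (map_pow _ _ _).symm⟩

theorem IsPrimitiveElement.norm {F L : Type*} [Field F] [Field L] [Algebra F L]
    [Finite L] {α : L} (hα : IsPrimitiveElement α) : IsPrimitiveElement (Algebra.norm F α) :=
  have : Finite F := Finite.of_injective _ (algebraMap F L).injective
  ⟨Algebra.norm_ne_zero_iff.mpr hα.1, fun _ hx => hα.exists_norm_pow_eq hx⟩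

theorem IsPrimitiveElement.orderOf_mk0 {L : Type*} [Field L] [Finite L] {α : L}
    (hα : IsPrimitiveElement α) : orderOf (Units.mk0 α hα.1) = Nat.card L - 1 := by
  rw [← Nat.card_zpowers, hα.zpowers_eq_top, Subgroup.card_top, Nat.card_units]

theorem IsPrimitiveElement.pow_eq_pow_iff {L : Type*} [Field L] [Finite L] {α : L}
    (hα : IsPrimitiveElement α) {m n : ℕ} :
    α ^ m = α ^ n ↔ m ≡ n [MOD Nat.card L - 1] := by
  rw [← hα.orderOf_mk0, ← _root_.pow_eq_pow_iff_modEq, Units.ext_iff]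
  simp

/-- Exponents of `ω` are determined modulo `q - 1`, hence modulo its divisor `v`. -/
theorem discreteLog_mod_eq {F L : Type*} [Field F] [Field L] [Algebra F L] [Finite L] {α : L}
    (hα : IsPrimitiveElement α) {v : ℕ} (hv : v ∣ Nat.card F - 1) (m : ℕ) :
    discreteLog (α ^ pointCount F L) (algebraMap F L (Algebra.norm F α ^ m)) % v = m % v := by
  have : Finite F := Finite.of_injective _ (algebraMap F L).injective
  have hω : α ^ pointCount F L = algebraMap F L (Algebra.norm F α) :=
    FiniteField.algebraMap_norm_eq_pow.symm
  rw [hω]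
  have hmem : discreteLog (algebraMap F L (Algebra.norm F α))
      (algebraMap F L (Algebra.norm F α ^ m)) ∈
      {i : ℕ | algebraMap F L (Algebra.norm F α) ^ i = algebraMap F L (Algebra.norm F α ^ m)} :=
    Nat.sInf_mem ⟨m, (map_pow _ _ _).symm⟩
  rw [Set.mem_ofPred_eq, ← map_pow] at hmem
  exact (hα.norm.pow_eq_pow_iff.mp ((algebraMap F L).injective hmem)).of_dvd hv

theorem cyclicTraceArrayMod_apply_of_trace_eq {F L : Type*} [Field F] [Field L] [Algebra F L]
    [Finite L] {α : L} (hα : IsPrimitiveElement α) {C : Finset ℕ} {v : ℕ}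
    (hv : v ∣ Nat.card F - 1) {i : Fin (v * pointCount F L)} {c : C} {m : ℕ}
    (h : Algebra.trace F L (α ^ ((i : ℕ) + (c : ℕ))) = Algebra.norm F α ^ m) :
    cyclicTraceArrayMod F α C v i c = m % v := by
  have : Finite F := Finite.of_injective _ (algebraMap F L).injective
  have hne : Algebra.norm F α ^ m ≠ 0 := pow_ne_zero _ hα.norm.1
  rw [cyclicTraceArrayMod, Matrix.of_apply, h, if_neg hne, discreteLog_mod_eq hα hv]

/-- A row can be found from any `y ≠ 0`, since multiplying `y` by the `v`-th power of a nonzero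
element of the base field does not change discrete logarithms modulo `v`. -/
theorem exists_row_cyclicTraceArrayMod {F L : Type*} [Field F] [Field L] [Algebra F L]
    [Finite L] {α : L} (hα : IsPrimitiveElement α) (C : Finset ℕ) {v : ℕ} (hv0 : 0 < v)
    (hw : 0 < pointCount F L) (hv : v ∣ Nat.card F - 1) {y : L} (hy : y ≠ 0) :
    ∃ i, ∀ (c : C) (m : ℕ), Algebra.trace F L (y * α ^ (c : ℕ)) = Algebra.norm F α ^ m →
      cyclicTraceArrayMod F α C v i c = m % v := by
  have : Finite F := Finite.of_injective _ (algebraMap F L).injective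
  obtain ⟨N, rfl⟩ := hα.2 y hy
  have hg : Algebra.norm F α ≠ 0 := hα.norm.1
  set k := N / (v * pointCount F L) with hk
  refine ⟨⟨N % (v * pointCount F L), Nat.mod_lt _ (by positivity)⟩, fun c m h => ?_⟩
  set i := N % (v * pointCount F L) with hi
  have hpow : α ^ N * α ^ (c : ℕ) = Algebra.norm F α ^ (v * k) • α ^ (i + (c : ℕ)) := by
    rw [Algebra.smul_def, map_pow, FiniteField.algebraMap_norm_eq_pow]
    change _ = (α ^ pointCount F L) ^ _ * _
    rw [← pow_mul, ← pow_add, ← pow_add]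
    congr 1
    rw [← Nat.div_add_mod N (v * pointCount F L), ← hk, ← hi]
    ring
  rw [hpow, map_smul, smul_eq_mul] at h
  have hne : Algebra.trace F L (α ^ (i + (c : ℕ))) ≠ 0 := fun h0 => by
    rw [h0, mul_zero] at h
    exact pow_ne_zero _ hg h.symm
  obtain ⟨m', hm'⟩ := hα.exists_norm_pow_eq hne
  rw [cyclicTraceArrayMod_apply_of_trace_eq hα hv hm'.symm]
  rw [← hm', ← pow_add] at h
  simpa [Nat.ModEq] using (hα.norm.pow_eq_pow_iff.mp h).of_dvd hv

/-! ### The columns as quadric points -/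

theorem pointCount_eq_of_card_eq_pow_four {F L : Type*} (hF : 1 < Nat.card F)
    (hL : Nat.card L = Nat.card F ^ 4) :
    pointCount F L = Nat.card F ^ 3 + Nat.card F ^ 2 + Nat.card F + 1 := by
  obtain ⟨p, hp⟩ : ∃ p, Nat.card F = p + 1 := ⟨_, (Nat.sub_add_cancel hF.le).symm⟩
  rw [pointCount, hL, hp]
  refine Nat.div_eq_of_eq_mul_left (by omega) (Nat.sub_eq_of_eq_add ?_)
  simp only [Nat.add_sub_cancel]
  ring

section Ovoid

variable {F L : Type*} [Field F] [Field L] [Algebra F L] [Finite L] {α : L}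

/-- Since `w = (q + 1) * (q ^ 2 + 1)`, the power is `ω ^ j`. -/
theorem pow_mul_pow_sq_add_one_mem (hL : Nat.card L = Nat.card F ^ 4) (j : ℕ) :
    (α ^ (j * (Nat.card F + 1))) ^ (Nat.card F ^ 2 + 1) ∈ (algebraMap F L).fieldRange := by
  have : Finite F := Finite.of_injective _ (algebraMap F L).injective
  refine ⟨Algebra.norm F α ^ j, ?_⟩
  rw [map_pow, FiniteField.algebraMap_norm_eq_pow]
  change (α ^ pointCount F L) ^ j = _
  rw [pointCount_eq_of_card_eq_pow_four Finite.one_lt_card hL, ← pow_mul, ← pow_mul]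
  ring_nf

/-- A nonzero element of `F` has `(q - 1)`-th power `1`; as `q ^ 4 - 1 = (q ^ 2 + 1) * (q + 1) * (q
- 1)`, this would give `j ≡ k` modulo `q ^ 2 + 1`. -/
theorem IsPrimitiveElement.pow_mul_div_notMem (hα : IsPrimitiveElement α)
    (hL : Nat.card L = Nat.card F ^ 4) {j k : ℕ} (hj : j ≤ Nat.card F ^ 2)
    (hk : k ≤ Nat.card F ^ 2) (hjk : j ≠ k) :
    α ^ (j * (Nat.card F + 1)) / α ^ (k * (Nat.card F + 1)) ∉ (algebraMap F L).fieldRange := by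
  have : Finite F := Finite.of_injective _ (algebraMap F L).injective
  intro h
  have h1 : 1 < Nat.card F := Finite.one_lt_card
  obtain ⟨p, hp⟩ : ∃ p, Nat.card F = p + 1 := ⟨_, (Nat.sub_add_cancel h1.le).symm⟩
  have hp0 : p ≠ 0 := by omega
  rw [FiniteField.mem_fieldRange_algebraMap_iff_pow_card, hp, pow_succ,
    mul_eq_right₀ (div_ne_zero (pow_ne_zero _ hα.1) (pow_ne_zero _ hα.1)), div_pow,
    div_eq_one_iff_eq (pow_ne_zero _ (pow_ne_zero _ hα.1)), ← pow_mul, ← pow_mul,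
    hα.pow_eq_pow_iff, hL, hp, mul_assoc, mul_assoc] at h
  have hcard : (p + 1) ^ 4 - 1 = ((p + 1) ^ 2 + 1) * ((p + 1 + 1) * p) :=
    Nat.sub_eq_of_eq_add (by ring)
  rw [hcard] at h
  have h' := Nat.ModEq.mul_right_cancel' (by positivity) h
  rw [hp] at hj hk
  exact hjk (h'.eq_of_lt_of_lt (by omega) (by omega))

end Ovoid

theorem sq_lt_cube_of_cube_add_le {q v n : ℕ} (hv : 0 < v) (hn : q - 1 = v * n)
    (hq : v ^ 3 + 4 * v ≤ q) : (q - n) ^ 2 < n ^ 3 := by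
  have h1 : v ^ 2 < n := by
    refine lt_of_mul_lt_mul_left (a := v) ?_ hv.le
    rw [← hn, ← pow_succ', show 2 + 1 = 3 from rfl]
    omega
  have h2 : q - n ≤ v * n := by omega
  calc (q - n) ^ 2 ≤ (v * n) ^ 2 := Nat.pow_le_pow_left h2 2
    _ = v ^ 2 * n ^ 2 := by ring
    _ < n * n ^ 2 := Nat.mul_lt_mul_of_pos_right h1 (pow_pos (Nat.zero_lt_of_lt h1) 2)
    _ = n ^ 3 := by ring

theorem mainTheorem3 {F L : Type*} [Field F] [Finite F] [Field L] [Algebra F L] (q : ℕ)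
    (hF : Nat.card F = q) (hL : Nat.card L = q ^ 4) (α : L) (hα : IsPrimitiveElement α)
    (C : Finset ℕ) (hC : C = (Finset.Icc 0 (q ^ 2)).image fun j => j * (q + 1))
    (v : ℕ) (hv : 0 < v) (hvq : v ∣ q - 1) (hq : v ^ 3 + 4 * v ≤ q) :
    IsCoveringArray (cyclicTraceArrayMod F α C v) (Finset.range v)
      (v * (q ^ 3 + q ^ 2 + q + 1)) 4 (q ^ 2 + 1) v := by
  subst hF
  have h1 : 1 < Nat.card F := Finite.one_lt_card
  have : Finite L := Nat.finite_of_card_ne_zero (by rw [hL]; positivity)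
  have hw := pointCount_eq_of_card_eq_pow_four h1 hL
  refine ⟨by simp [hw], ?_, by simp, fun i c => ?_, by norm_num, by nlinarith, ?_, ?_⟩
  · rw [Fintype.card_coe, hC, Finset.card_image_of_injective _ fun a b h =>
      Nat.eq_of_mul_eq_mul_right (Nat.succ_pos _) h]
    simp
  · rw [cyclicTraceArrayMod, Matrix.of_apply, Finset.mem_range]
    split_ifs
    exacts [hv, Nat.mod_lt _ hv]
  · have : v ^ 3 ≤ Nat.card F ^ 3 + Nat.card F ^ 2 + Nat.card F + 1 := by
      have := Nat.zero_le (Nat.card F ^ 3 + Nat.card F ^ 2); omega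
    calc v ^ 4 = v * v ^ 3 := by ring
      _ ≤ _ := Nat.mul_le_mul_left v this
  intro T hT x hx
  have hCj : ∀ c : C, ∃ j ≤ Nat.card F ^ 2, (c : ℕ) = j * (Nat.card F + 1) := fun c => by
    obtain ⟨j, hj, hjc⟩ := Finset.mem_image.mp ((Finset.ext_iff.mp hC _).mp c.2)
    exact ⟨j, (Finset.mem_Icc.mp hj).2, hjc.symm⟩
  let e : T ≃ Fin 4 := T.equivFinOfCardEq hT
  let a : Fin 4 → L := fun j => α ^ ((e.symm j : C) : ℕ)
  have ha : ∀ j : Fin 4, LinearIndependent F (a ∘ j.succAbove) := fun j => by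
    refine linearIndependent_of_pow_sq_add_one_mem (fun i => pow_ne_zero _ hα.1) (fun i => ?_)
      fun i k hik => ?_
    · obtain ⟨m, -, hm⟩ := hCj (e.symm (j.succAbove i))
      simp only [a, Function.comp_apply, hm]
      exact pow_mul_pow_sq_add_one_mem hL m
    · obtain ⟨m, hm0, hm⟩ := hCj (e.symm (j.succAbove i))
      obtain ⟨n, hn0, hn⟩ := hCj (e.symm (j.succAbove k))
      simp only [a, Function.comp_apply, hm, hn]
      refine hα.pow_mul_div_notMem hL hm0 hn0 fun hmn => hik ?_
      refine Fin.succAbove_right_injective (p := j) (e.symm.injective (Subtype.ext (Subtype.ext ?_)))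
      rw [hm, hn, hmn]
  have hg := hα.norm (F := F)
  obtain ⟨n, hn⟩ := hvq
  let G : Fˣ := Units.mk0 (Algebra.norm F α) hg.1
  have hcard : Nat.card (Subgroup.zpowers (G ^ v)) = n := by
    rw [Nat.card_zpowers, orderOf_pow_of_dvd hv.ne' (by rw [hg.orderOf_mk0]; exact ⟨n, hn⟩),
      hg.orderOf_mk0, hn, Nat.mul_div_cancel_left _ hv]
  obtain ⟨y, h, hy⟩ := exists_trace_mul_mem_coset ha (Subgroup.zpowers (G ^ v))
    (hcard.symm ▸ sq_lt_cube_of_cube_add_le hv hn hq) fun j => G ^ x (e.symm j)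
  have hy0 : y ≠ 0 := fun h0 => by
    have := hy 0
    rw [h0, zero_mul, map_zero, ← Units.val_mul] at this
    exact Units.ne_zero _ this.symm
  obtain ⟨i, hi⟩ := exists_row_cyclicTraceArrayMod hα C hv (hw ▸ by positivity) ⟨n, hn⟩ hy0
  refine ⟨i, fun c hc => ?_⟩
  -- The coset factor is `G ^ (v * l)`, which leaves the logarithm modulo `v` unchanged.
  obtain ⟨l, hl⟩ := mem_powers_iff_mem_zpowers.mpr (h (e ⟨c, hc⟩)).2
  have hyc := hy (e ⟨c, hc⟩)
  simp only [a, Equiv.symm_apply_apply, ← hl, ← pow_mul, ← Units.val_mul, ← pow_add] at hyc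
  rw [hi c (x c + v * l) (by simpa [G] using hyc), Nat.add_mul_mod_self_left]
  exact Nat.mod_eq_of_lt (Finset.mem_range.mp (hx c hc))
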